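/- For $\omega$ in the upper half-plane let $G_m(\omega)=\sum_{(n_1,n_2)\in\mathbb Z^2\setminus\{(0,0)\}}(n_1\omega+n_2)^{-2m}$ for $m\ge 2$, $g_2=60\,G_2$, $g_3=140\,G_3$, $\Delta=g_2^3-27g_3^2$, and let $j=2^6 3^3 g_2^3/\Delta$ be the absolute invariant. For a positive integer $s$ let $S_1,\dots,S_{\psi(s)}$ be the integer matrices $\begin{pmatrix}a&b\\0&d\end{pmatrix}$ with $a>0$, $ad=s$, $0\le b<d$ and $\gcd(a,b,d)=1$; they act by $S_\nu(\omega)=(a\omega+b)/d$. Then: (1) For every $s\ge 1$ there is a unique polynomial $J_s(X,Y)\in\mathbb Z[X,Y]$ such that for all $\omega$ in the upper half-plane $$J_s(X,j(\omega))=\prod_{\nu=1}^{\psi(s)}\bigl(X-j(S_\nu(\omega))\bigr).$$ (2) For every prime $p$ one has $J_p(X,Y)\equiv (X^p-Y)(X-Y^p) \pmod p$, i.e. all coefficients of the difference are divisible by $p$. -/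

import Mathlib

open Polynomial UpperHalfPlane

namespace ModularTransformation

noncomputable section

/-- The lattice sum `∑ (m ω + n)^(-2k)` over all integer pairs `(m, n) ≠ (0, 0)`. -/
def G (k : ℕ) (ω : ℂ) : ℂ :=
  ∑' v : {v : Fin 2 → ℤ // v ≠ 0}, ((v.1 0 : ℂ) * ω + (v.1 1 : ℂ)) ^ (-(2 * (k : ℤ)))

/-- The Weierstrass invariant `g₂`. -/
def g₂ (ω : ℂ) : ℂ := 60 * G 2 ω

/-- The Weierstrass invariant `g₃`. -/
def g₃ (ω : ℂ) : ℂ := 140 * G 3 ω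

/-- The discriminant of the lattice `ℤ ω + ℤ`. -/
def discr (ω : ℂ) : ℂ := g₂ ω ^ 3 - 27 * g₃ ω ^ 2

/-- The absolute invariant `j` (used only for `Im ω > 0`). -/
def j (ω : ℂ) : ℂ := 2 ^ 6 * 3 ^ 3 * g₂ ω ^ 3 / discr ω

/-- The fractional linear transformation `ω ↦ (a ω + b) / (c ω + d)`. -/
def moebius (S : Matrix (Fin 2) (Fin 2) ℤ) (ω : ℂ) : ℂ :=
  ((S 0 0 : ℂ) * ω + (S 0 1 : ℂ)) / ((S 1 0 : ℂ) * ω + (S 1 1 : ℂ))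

/-- The triangular representatives of the primitive integer matrices of determinant `s`
modulo left multiplication by the modular group: all `(a b; 0 d)` with `a > 0`, `a d = s`,
`0 ≤ b < d` and `gcd (a, b, d) = 1`. -/
def reps (s : ℕ) : Finset (Matrix (Fin 2) (Fin 2) ℤ) :=
  (((s.divisors ×ˢ Finset.range s) ×ˢ s.divisors).filter fun t =>
      t.1.1 * t.2 = s ∧ t.1.2 < t.2 ∧ Nat.gcd (Nat.gcd t.1.1 t.1.2) t.2 = 1).image
    fun t => !![(t.1.1 : ℤ), (t.1.2 : ℤ); 0, (t.2 : ℤ)]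

theorem mem_reps {s : ℕ} (hs : 0 < s) (S : Matrix (Fin 2) (Fin 2) ℤ) :
    S ∈ reps s ↔ S 1 0 = 0 ∧ 0 < S 0 0 ∧ S 0 0 * S 1 1 = s ∧ 0 ≤ S 0 1 ∧ S 0 1 < S 1 1 ∧
      Int.gcd (Int.gcd (S 0 0) (S 0 1)) (S 1 1) = 1 := by
  simp only [reps, Finset.mem_image, Finset.mem_filter, Finset.mem_product, Nat.mem_divisors,
    Finset.mem_range, Prod.exists]
  constructor
  · rintro ⟨a, b, d, ⟨-, h1, h2, h3⟩, rfl⟩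
    have ha : 0 < a := Nat.pos_of_ne_zero (by rintro rfl; simp at h1; omega)
    refine ⟨by simp, by simpa using ha, by simp [← h1], by simp, by simpa using h2, ?_⟩
    simpa using h3
  · rintro ⟨h0, ha, h1, hb, hbd, hg⟩
    obtain ⟨a, ea⟩ := Int.eq_ofNat_of_zero_le ha.le
    obtain ⟨b, eb⟩ := Int.eq_ofNat_of_zero_le hb
    obtain ⟨d, ed⟩ := Int.eq_ofNat_of_zero_le (hb.trans hbd.le)
    rw [ea] at ha
    rw [ea, ed] at h1
    rw [eb, ed] at hbd
    rw [ea, eb, ed] at hg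
    have h1' : a * d = s := by exact_mod_cast h1
    have hbd' : b < d := by exact_mod_cast hbd
    have ha' : 0 < a := by exact_mod_cast ha
    refine ⟨a, b, d, ⟨⟨⟨⟨⟨d, h1'.symm⟩, hs.ne'⟩, ?_⟩, ⟨⟨a, ?_⟩, hs.ne'⟩⟩, h1', hbd', ?_⟩, ?_⟩
    · nlinarith
    · rw [mul_comm, h1']
    · simpa using hg
    · ext i k
      fin_cases i <;> fin_cases k <;> simp [ea, eb, ed, h0]

/-- The principal polynomial `∏_ν (X - j (S_ν ω))` of level `s`, at the point `ω`. -/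
def principalPoly (s : ℕ) (ω : ℂ) : ℂ[X] :=
  ∏ S ∈ reps s, (X - C (j (moebius S ω)))

/-- `F ∈ ℤ[Y][X]` expresses the principal polynomial of level `s` as a polynomial in `X` (the
outer variable) and `Y = j(ω)` (the inner variable): `F(X, j(ω)) = ∏_ν (X - j (S_ν ω))` as
polynomials in `X`, for all `ω` in the upper half-plane. -/
def IsModularPolynomial (s : ℕ) (F : ℤ[X][X]) : Prop :=
  ∀ ω : ℍ, F.map (eval₂RingHom (Int.castRingHom ℂ) (j (ω : ℂ))) = principalPoly s (ω : ℂ)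

end

end ModularTransformation

namespace ModularTransformation

noncomputable section

open ModularForm EisensteinSeries MatrixGroups

lemma G_eq_riemannZeta_mul_E {k : ℕ} (hk : 3 ≤ 2 * k) (τ : ℍ) :
    G k τ = 2 * riemannZeta (2 * k : ℕ) * E hk τ := by
  have h0 : ∑' v : Fin 2 → ℤ, eisSummand (2 * k : ℕ) v τ = G k τ := by
    rw [G]
    refine (tsum_subtype_eq_of_support_subset (s := {v : Fin 2 → ℤ | v ≠ 0}) ?_).symm.trans ?_
    · intro v hv h
      apply hv
      subst h
      have : -((2 * k : ℕ) : ℤ) ≠ 0 := by omega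
      simp only [eisSummand, Pi.zero_apply, Int.cast_zero, zero_mul, add_zero]
      exact zero_zpow _ this
    · refine tsum_congr fun v => ?_
      simp [eisSummand]
  rw [← h0, tsum_eisSummand_eq_riemannZeta_mul_eisensteinSeries hk,
    show E hk τ = (1 / 2 : ℂ) • eisensteinSeriesSIF (N := 1) 0 (2 * k : ℕ) τ from rfl]
  rw [eisensteinSeriesSIF_apply, smul_eq_mul]
  ring

lemma riemannZeta_six : riemannZeta 6 = Real.pi ^ 6 / 945 := by
  have h := riemannZeta_two_mul_nat (k := 3) (by norm_num)
  have hb : _root_.bernoulli 6 = 1 / 42 := by decide +kernel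
  norm_num [hb, Nat.factorial] at h
  rw [h]
  ring

/-- The absolute invariant as the quotient of `E₄³` by the discriminant `η²⁴`. -/
lemma j_eq_E₄_cube_div (τ : ℍ) : j τ = E₄ τ ^ 3 / ModularForm.discriminant τ := by
  have h2 : g₂ τ = 60 * (2 * (Real.pi ^ 4 / 90) * E₄ τ) := by
    rw [g₂, G_eq_riemannZeta_mul_E (by norm_num), ← riemannZeta_four]
    norm_num
  have h3 : g₃ τ = 140 * (2 * (Real.pi ^ 6 / 945) * E₆ τ) := by
    rw [g₃, G_eq_riemannZeta_mul_E (by norm_num), ← riemannZeta_six]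
    norm_num
  have hΔ := discriminant_eq_E₄_cube_sub_E₆_sq τ
  have hne := ModularForm.discriminant_ne_zero τ
  have hπ : (Real.pi : ℂ) ≠ 0 := by exact_mod_cast Real.pi_ne_zero
  have hd : discr τ = 2 ^ 12 * Real.pi ^ 12 * ModularForm.discriminant τ := by
    rw [discr, h2, h3, hΔ]
    ring
  rw [j, hd, h2]
  field_simp
  ring

lemma j_smul (γ : SL(2, ℤ)) (τ : ℍ) : j ((γ • τ : ℍ) : ℂ) = j τ := by
  have hγ : γ ∈ CongruenceSubgroup.Gamma 1 := CongruenceSubgroup.mem_Gamma_one γ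
  have h4 : E₄ (γ • τ) = denom γ τ ^ (4 : ℤ) * E₄ τ := by
    have : SlashInvariantFormClass (ModularForm 𝒮ℒ 4) (CongruenceSubgroup.Gamma 1) 4 :=
      CongruenceSubgroup.Gamma_one_coe_eq_SL ▸ inferInstance
    exact SlashInvariantForm.slash_action_eqn_SL'' E₄ hγ τ
  have hd : CuspForm.discriminant (γ • τ) =
      denom γ τ ^ (12 : ℤ) * CuspForm.discriminant τ := by
    have : SlashInvariantFormClass (CuspForm 𝒮ℒ 12) (CongruenceSubgroup.Gamma 1) 12 :=
      CongruenceSubgroup.Gamma_one_coe_eq_SL ▸ inferInstance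
    exact SlashInvariantForm.slash_action_eqn_SL'' CuspForm.discriminant hγ τ
  have hne := ModularForm.discriminant_ne_zero τ
  have hden : denom γ τ ≠ 0 := denom_ne_zero _ _
  rw [j_eq_E₄_cube_div, j_eq_E₄_cube_div, h4, ← CuspForm.coe_discriminant, hd]
  rw [← CuspForm.coe_discriminant] at hne
  field_simp

end

noncomputable section

open ModularForm EisensteinSeries MatrixGroups Function.Periodic ArithmeticFunction
open scoped ArithmeticFunction.sigma PowerSeries Manifold Topology

/-- The generating series of the divisor sums `σ k`. -/
def sigmaSeries (k : ℕ) : ℤ⟦X⟧ := PowerSeries.mk fun n => (σ k n : ℤ)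

/-- The `q`-expansion of `E₄` with integral coefficients. -/
def E₄Series : ℤ⟦X⟧ := 1 + 240 * sigmaSeries 3

/-- The `q`-expansion of `E₆` with integral coefficients. -/
def E₆Series : ℤ⟦X⟧ := 1 - 504 * sigmaSeries 5

/-- The `q`-expansion of the discriminant `(E₄³ - E₆²) / 1728` with integral coefficients. -/
def discrSeries : ℤ⟦X⟧ :=
  PowerSeries.mk (fun n => ∑ d ∈ n.divisors, (5 * (d : ℤ) ^ 3 + 7 * (d : ℤ) ^ 5) / 12) +
    100 * sigmaSeries 3 ^ 2 + 8000 * sigmaSeries 3 ^ 3 - 147 * sigmaSeries 5 ^ 2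

lemma twelve_dvd_five_cube_add_seven_pow_five (d : ℤ) : 12 ∣ 5 * d ^ 3 + 7 * d ^ 5 := by
  have h : ∀ x : ZMod 12, 5 * x ^ 3 + 7 * x ^ 5 = 0 := by decide
  have := h d
  exact (ZMod.intCast_zmod_eq_zero_iff_dvd _ 12).mp (by push_cast; exact this)

lemma discrSeries_mul : 1728 * discrSeries = E₄Series ^ 3 - E₆Series ^ 2 := by
  have h : 12 * PowerSeries.mk
      (fun n => ∑ d ∈ n.divisors, (5 * (d : ℤ) ^ 3 + 7 * (d : ℤ) ^ 5) / 12) =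
      5 * sigmaSeries 3 + 7 * sigmaSeries 5 := by
    ext n
    rw [show (12 : ℤ⟦X⟧) = PowerSeries.C 12 from rfl, show (5 : ℤ⟦X⟧) = PowerSeries.C 5 from rfl,
      show (7 : ℤ⟦X⟧) = PowerSeries.C 7 from rfl]
    simp only [sigmaSeries, map_add, PowerSeries.coeff_C_mul, PowerSeries.coeff_mk, sigma_apply]
    push_cast
    simp only [Finset.mul_sum]
    rw [← Finset.sum_add_distrib]
    exact Finset.sum_congr rfl fun d _ =>
      Int.mul_ediv_cancel' (twelve_dvd_five_cube_add_seven_pow_five d)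
  rw [discrSeries, E₄Series, E₆Series]
  linear_combination 144 * h

lemma map_E₄Series : E₄Series.map (Int.castRingHom ℂ) = qExpansion 1 E₄ := by
  ext n
  have h : E₄Series.coeff n = (if n = 0 then 1 else 0) + 240 * (σ 3 n : ℤ) := by
    rw [E₄Series, show (240 : ℤ⟦X⟧) = PowerSeries.C 240 from rfl]
    simp only [map_add, PowerSeries.coeff_one, PowerSeries.coeff_C_mul, sigmaSeries,
      PowerSeries.coeff_mk]
  have hb : _root_.bernoulli 4 = -1 / 30 := by decide +kernel
  rw [E_qExpansion_coeff _ ⟨2, rfl⟩, PowerSeries.coeff_map, h]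
  rcases eq_or_ne n 0 with rfl | hn
  · simp
  · norm_num [hn, hb]

lemma map_E₆Series : E₆Series.map (Int.castRingHom ℂ) = qExpansion 1 E₆ := by
  ext n
  have h : E₆Series.coeff n = (if n = 0 then 1 else 0) - 504 * (σ 5 n : ℤ) := by
    rw [E₆Series, show (504 : ℤ⟦X⟧) = PowerSeries.C 504 from rfl]
    simp only [map_sub, PowerSeries.coeff_one, PowerSeries.coeff_C_mul, sigmaSeries,
      PowerSeries.coeff_mk]
  have hb : _root_.bernoulli 6 = 1 / 42 := by decide +kernel
  rw [E_qExpansion_coeff _ ⟨3, rfl⟩, PowerSeries.coeff_map, h]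
  rcases eq_or_ne n 0 with rfl | hn
  · simp
  · norm_num [hn, hb]

lemma map_discrSeries :
    discrSeries.map (Int.castRingHom ℂ) = qExpansion 1 ModularForm.discriminant := by
  let f : ModularForm 𝒮ℒ 12 :=
    ModularForm.mcast (by decide) (E₄.pow 3) - ModularForm.mcast (by decide) (E₆.pow 2)
  have hf : (1728 : ℂ) • (CuspForm.discriminant : ℍ → ℂ) = f := by
    ext τ
    change 1728 * ModularForm.discriminant τ = (E₄.pow 3) τ - (E₆.pow 2) τ
    rw [ModularForm.coe_pow, ModularForm.coe_pow, discriminant_eq_E₄_cube_sub_E₆_sq τ]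
    simp only [Pi.pow_apply]
    ring
  have hq : qExpansion 1 f = qExpansion 1 E₄ ^ 3 - qExpansion 1 E₆ ^ 2 := by
    simp only [f, FunLike.coe_sub, coe_mcast,
      ModularForm.qExpansion_sub one_pos one_mem_strictPeriods_SL,
      ModularForm.qExpansion_pow one_pos one_mem_strictPeriods_SL]
  rw [← hf, ModularForm.qExpansion_smul one_pos one_mem_strictPeriods_SL (1728 : ℂ)
      CuspForm.discriminant, ← map_E₄Series, ← map_E₆Series, ← map_pow, ← map_pow, ← map_sub,
      ← discrSeries_mul, map_mul, CuspForm.coe_discriminant] at hq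
  ext n
  have := congrArg (PowerSeries.coeff n) hq
  rw [show (1728 : ℤ⟦X⟧) = PowerSeries.C 1728 from rfl, PowerSeries.map_C,
    PowerSeries.coeff_C_mul] at this
  simpa using this.symm

/-- The discriminant series divided by `q`. -/
def discrShift : ℤ⟦X⟧ := PowerSeries.mk fun n => discrSeries.coeff (n + 1)

lemma discrSeries_eq_X_mul : discrSeries = PowerSeries.X * discrShift := by
  have h0 : discrSeries.constantCoeff = 0 := by
    simp [discrSeries, sigmaSeries]
  have := PowerSeries.sub_const_eq_X_mul_shift discrSeries
  rwa [h0, _root_.map_zero, sub_zero] at this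

lemma constantCoeff_discrShift : discrShift.constantCoeff = 1 := by
  have h1 := congrArg (PowerSeries.coeff 1) map_discrSeries
  rw [discriminant_qExpansion_coeff_one, PowerSeries.coeff_map] at h1
  rw [← PowerSeries.coeff_zero_eq_constantCoeff_apply, discrShift, PowerSeries.coeff_mk]
  rw [eq_intCast] at h1
  exact_mod_cast h1

/-- The `q`-expansion of `q j` with integral coefficients. -/
def jSeries : ℤ⟦X⟧ := E₄Series ^ 3 * PowerSeries.invOfUnit discrShift 1

lemma jSeries_mul_discrShift : jSeries * discrShift = E₄Series ^ 3 := by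
  rw [jSeries, mul_assoc, mul_comm _ discrShift,
    PowerSeries.mul_invOfUnit _ _ (by simpa using constantCoeff_discrShift), mul_one]

lemma constantCoeff_jSeries : jSeries.constantCoeff = 1 := by
  have := congrArg PowerSeries.constantCoeff jSeries_mul_discrShift
  rw [map_mul, constantCoeff_discrShift, mul_one] at this
  rw [this]
  simp [E₄Series, sigmaSeries]

lemma mdifferentiable_qParam (h : ℝ) : MDiff (fun τ : ℍ => qParam h τ) := by
  rw [UpperHalfPlane.mdifferentiable_iff]
  refine (differentiable_qParam (h := h)).differentiableOn.congr fun z hz => ?_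
  simp [ofComplex_apply_of_im_pos hz]

lemma cuspFunction_zero_fun (h : ℝ) : UpperHalfPlane.cuspFunction h 0 = 0 := by
  simpa [UpperHalfPlane.cuspFunction, Function.Periodic.cuspFunction]
    using! (tendsto_const_nhds.mono_left nhdsWithin_le_nhds).limUnder_eq

/-- Coefficients of a convergent `q`-expansion are determined by the function. -/
lemma coeff_eq_of_hasSum_qParam {h : ℝ} (hh : 0 < h) {f : ℍ → ℂ} {c d : ℕ → ℂ}
    (hc : ∀ τ : ℍ, HasSum (fun m => c m * qParam h τ ^ m) (f τ))
    (hd : ∀ τ : ℍ, HasSum (fun m => d m * qParam h τ ^ m) (f τ)) : c = d := by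
  have hs (τ : ℍ) : HasSum (fun m => (c - d) m • qParam h τ ^ m) ((0 : ℍ → ℂ) τ) := by
    simpa [sub_mul] using (hc τ).sub (hd τ)
  have h0 : UpperHalfPlane.cuspFunction h 0 = 0 := cuspFunction_zero_fun h
  have h1 := hasFPowerSeriesOnBall_cuspFunction hh (by rw [h0]; exact analyticAt_const) hs
  rw [h0] at h1
  have h2 := h1.hasFPowerSeriesAt.eq_zero
  ext m
  have := congrArg (fun p => FormalMultilinearSeries.coeff p m) h2
  have hz : (0 : FormalMultilinearSeries ℂ ℂ ℂ).coeff m = 0 := rfl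
  simp only [FormalMultilinearSeries.coeff_ofScalars, hz] at this
  exact sub_eq_zero.mp this

lemma isZeroAtImInfty_qParam : IsZeroAtImInfty (fun τ : ℍ => qParam 1 τ) :=
  qParam_tendsto_atImInfty one_pos

lemma periodic_comp_ofComplex_of_vadd {f : ℍ → ℂ} (hf : ∀ τ, f ((1 : ℝ) +ᵥ τ) = f τ) :
    Function.Periodic (f ∘ ofComplex) (1 : ℝ) := by
  intro w
  by_cases! hw : 0 < w.im
  · have : 0 < (w + (1 : ℝ)).im := by simp [hw]
    simp only [Function.comp_apply, ofComplex_apply_of_im_pos this, ofComplex_apply_of_im_pos hw]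
    rw [← hf ⟨w, hw⟩]
    congr 1
    ext
    simp [add_comm]
  · have : (w + (1 : ℝ)).im ≤ 0 := by simpa using hw
    simp only [Function.comp_apply, ofComplex_apply_of_im_nonpos this,
      ofComplex_apply_of_im_nonpos hw]

lemma qParam_vadd (τ : ℍ) : qParam 1 (((1 : ℝ) +ᵥ τ : ℍ) : ℂ) = qParam 1 τ := by
  rw [coe_vadd, qParam, qParam, ← Complex.exp_periodic (2 * Real.pi * Complex.I * τ / (1 : ℝ))]
  congr 1
  push_cast
  ring

lemma qExpansion_qParam : qExpansion 1 (fun τ : ℍ => qParam 1 τ) = PowerSeries.X := by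
  have hsum (τ : ℍ) : HasSum (fun m : ℕ => (if m = 1 then (1 : ℂ) else 0) * qParam 1 τ ^ m)
      (qParam 1 τ) := by
    convert hasSum_single (f := fun m : ℕ => (if m = 1 then (1 : ℂ) else 0) * qParam 1 τ ^ m) 1
      (fun b hb => by rw [if_neg hb, zero_mul]) using 1
    rw [if_pos rfl, one_mul, pow_one]
  ext n
  rw [PowerSeries.coeff_X]
  refine congrFun (coeff_eq_of_hasSum_qParam one_pos (c := fun n => (qExpansion 1 _).coeff n)
    (fun τ => ?_) hsum) n
  exact hasSum_qExpansion (f := fun τ : ℍ => qParam 1 τ) one_pos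
    (periodic_comp_ofComplex_of_vadd qParam_vadd) (mdifferentiable_qParam 1)
    isZeroAtImInfty_qParam.isBoundedAtImInfty τ

lemma isBoundedAtImInfty_qParam_mul_j : IsBoundedAtImInfty (fun τ : ℍ => qParam 1 τ * j τ) := by
  have h1 : (fun τ : ℍ => qParam 1 τ) =O[atImInfty] ModularForm.discriminant := by
    refine Asymptotics.IsBigO.trans (.of_bound 1 (.of_forall fun τ => ?_)) exp_isBigO_discriminant
    simp [norm_qParam]
  have h2 : IsBoundedAtImInfty (E₄.pow 3) := ModularFormClass.bdd_at_infty (E₄.pow 3)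
  have h3 : (fun τ : ℍ => (E₄.pow 3) τ) =O[atImInfty] (fun _ => (1 : ℂ)) :=
    h2.trans (Asymptotics.isBigO_const_const _ one_ne_zero _)
  have h4 := (h1.mul h3).mul
    (Asymptotics.isBigO_refl (fun τ => (ModularForm.discriminant τ)⁻¹) atImInfty)
  refine (h4.congr (f₂ := fun τ : ℍ => qParam 1 τ * j τ) (g₂ := fun _ => (1 : ℂ))
    (fun τ => ?_) (fun τ => ?_)).trans (Asymptotics.isBigO_const_const _ one_ne_zero _)
  · rw [j_eq_E₄_cube_div, ModularForm.coe_pow, Pi.pow_apply]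
    ring
  · rw [mul_one, mul_inv_cancel₀ (ModularForm.discriminant_ne_zero τ)]

lemma mdifferentiable_j : MDiff (fun τ : ℍ => j τ) := by
  have : (fun τ : ℍ => j τ) = fun τ : ℍ => (E₄.pow 3) τ / CuspForm.discriminant τ := by
    ext τ
    rw [j_eq_E₄_cube_div, ModularForm.coe_pow]
    rfl
  rw [this]
  exact (E₄.pow 3).holo'.div CuspForm.discriminant.holo' ModularForm.discriminant_ne_zero

lemma j_vadd (τ : ℍ) : j ((((1 : ℝ) +ᵥ τ : ℍ)) : ℂ) = j τ := by
  rw [← modular_T_smul, j_smul]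

lemma periodic_qParam_mul_j :
    Function.Periodic ((fun τ : ℍ => qParam 1 τ * j τ) ∘ ofComplex) (1 : ℝ) :=
  periodic_comp_ofComplex_of_vadd fun τ => by rw [qParam_vadd, j_vadd]

lemma analyticAt_cuspFunction_qParam_mul_j :
    AnalyticAt ℂ (cuspFunction 1 (fun τ : ℍ => qParam 1 τ * j τ)) 0 :=
  analyticAt_cuspFunction_zero one_pos periodic_qParam_mul_j
    ((mdifferentiable_qParam 1).mul mdifferentiable_j) isBoundedAtImInfty_qParam_mul_j

lemma map_jSeries :
    jSeries.map (Int.castRingHom ℂ) = qExpansion 1 (fun τ : ℍ => qParam 1 τ * j τ) := by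
  have hF := analyticAt_cuspFunction_qParam_mul_j
  have hQ : AnalyticAt ℂ (cuspFunction 1 (fun τ : ℍ => qParam 1 τ)) 0 :=
    analyticAt_cuspFunction_zero one_pos (periodic_comp_ofComplex_of_vadd qParam_vadd)
      (mdifferentiable_qParam 1) isZeroAtImInfty_qParam.isBoundedAtImInfty
  have hD := ModularFormClass.analyticAt_cuspFunction_zero CuspForm.discriminant one_pos
    one_mem_strictPeriods_SL
  have hE := ModularFormClass.analyticAt_cuspFunction_zero (E₄.pow 3) one_pos
    one_mem_strictPeriods_SL
  have h : (fun τ : ℍ => qParam 1 τ * j τ) * ⇑CuspForm.discriminant =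
      (fun τ : ℍ => qParam 1 τ) * ⇑(E₄.pow 3) := by
    ext τ
    have := ModularForm.discriminant_ne_zero τ
    simp only [Pi.mul_apply, j_eq_E₄_cube_div, ModularForm.coe_pow, Pi.pow_apply,
      CuspForm.coe_discriminant]
    field_simp
  have h2 := congrArg (qExpansion 1) h
  rw [qExpansion_mul hF hD, qExpansion_mul hQ hE, qExpansion_qParam,
    ModularForm.qExpansion_pow one_pos one_mem_strictPeriods_SL, CuspForm.coe_discriminant,
    ← map_discrSeries, ← map_E₄Series, ← map_pow, ← jSeries_mul_discrShift, discrSeries_eq_X_mul,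
    map_mul, map_mul, PowerSeries.map_X] at h2
  have hne : discrShift.map (Int.castRingHom ℂ) ≠ 0 := by
    intro h0
    have := congrArg PowerSeries.constantCoeff h0
    rw [← PowerSeries.coeff_zero_eq_constantCoeff_apply, PowerSeries.coeff_map,
      PowerSeries.coeff_zero_eq_constantCoeff_apply, constantCoeff_discrShift] at this
    simp at this
  refine mul_right_cancel₀ (mul_ne_zero PowerSeries.X_ne_zero hne) ?_
  rw [h2]
  ring

lemma hasSum_jSeries (τ : ℍ) :
    HasSum (fun n => (jSeries.coeff n : ℂ) * qParam 1 τ ^ n) (qParam 1 τ * j τ) := by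
  have := hasSum_qExpansion (f := fun τ : ℍ => qParam 1 τ * j τ) one_pos
    periodic_qParam_mul_j ((mdifferentiable_qParam 1).mul mdifferentiable_j)
    isBoundedAtImInfty_qParam_mul_j τ
  rw [← map_jSeries] at this
  simpa using this

end

noncomputable section

open ModularForm EisensteinSeries MatrixGroups Function.Periodic ArithmeticFunction
open scoped ArithmeticFunction.sigma PowerSeries Manifold Topology

lemma mdifferentiable_of_hasSum_qParam {h : ℝ} (hh : 0 < h) {f : ℍ → ℂ} {c : ℕ → ℂ}
    (hf : ∀ τ : ℍ, HasSum (fun m => c m * qParam h τ ^ m) (f τ)) : MDiff f := by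
  let p : FormalMultilinearSeries ℂ ℂ ℂ := .ofScalars ℂ c
  have hr : 1 ≤ p.radius := by
    refine le_of_forall_lt_imp_le_of_dense fun r hr => ?_
    rcases eq_or_ne r 0 with rfl | hr'
    · simp
    · lift r to NNReal using hr.ne_top
      have hr1 : ‖((r : ℝ) : ℂ)‖ < 1 := by simpa using hr
      have hr0 : ((r : ℝ) : ℂ) ≠ 0 := by exact_mod_cast hr'
      apply FormalMultilinearSeries.le_radius_of_summable
      have := (hf ⟨_, im_invQParam_pos_of_norm_lt_one hh hr1 hr0⟩).summable.norm
      simp only [qParam_right_inv hh.ne' hr0] at this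
      simpa [p] using this
  have hp : DifferentiableOn ℂ p.sum (Metric.ball 0 1) := by
    have h1 := (p.hasFPowerSeriesOnBall (one_pos.trans_le hr)).mono one_pos hr
    have := h1.differentiableOn
    rwa [← ENNReal.coe_one, Metric.eball_coe, NNReal.coe_one] at this
  have hfp (τ : ℍ) : f τ = p.sum (qParam h τ) := by
    rw [← (hf τ).tsum_eq]
    simp [p, FormalMultilinearSeries.sum, mul_comm]
  rw [UpperHalfPlane.mdifferentiable_iff]
  refine (hp.comp (differentiable_qParam (h := h)).differentiableOn
    fun z hz => ?_).congr fun z hz => ?_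
  · simpa using norm_qParam_lt_one hh hz
  · simp [ofComplex_apply_of_im_pos hz, hfp]

/-- An `SL(2, ℤ)`-invariant function with a `q`-expansion without polar part is constant. -/
lemma eq_const_of_invariant_of_hasSum {c : ℍ → ℂ} (hc : ∀ (γ : SL(2, ℤ)) τ, c (γ • τ) = c τ)
    {a : ℕ → ℂ} (hs : ∀ τ : ℍ, HasSum (fun n => a n * qParam 1 τ ^ n) (c τ)) (τ : ℍ) :
    c τ = a 0 := by
  have hslash (γ : SL(2, ℤ)) : c ∣[(0 : ℤ)] γ = c := by
    ext τ
    rw [SL_slash_apply]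
    simpa using hc γ τ
  let f : ModularForm 𝒮ℒ 0 :=
    { toFun := c
      slash_action_eq' := by
        rintro _ ⟨γ, rfl⟩
        exact hslash γ
      holo' := mdifferentiable_of_hasSum_qParam one_pos hs
      bdd_at_cusps' := by
        intro x hx
        rw [Subgroup.IsArithmetic.isCusp_iff_isCusp_SL2Z] at hx
        rw [OnePoint.isBoundedAt_iff_forall_SL2Z hx]
        intro γ _
        rw [hslash]
        exact isBoundedAtImInfty_of_hasSum_qExpansion one_pos hs }
  obtain ⟨b, hb⟩ := ModularFormClass.levelOne_weight_zero_const f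
  have hb' (τ : ℍ) : c τ = b := congrFun hb τ
  have : a = fun n => if n = 0 then b else 0 := by
    refine coeff_eq_of_hasSum_qParam one_pos hs fun τ => ?_
    convert hasSum_single (f := fun m : ℕ => (if m = 0 then b else 0) * qParam 1 τ ^ m) 0
      (fun n hn => by rw [if_neg hn, zero_mul]) using 1
    rw [if_pos rfl, pow_zero, mul_one, hb']
  rw [hb', this]
  rfl

lemma hasSum_coeff_mul {f g : ℂ⟦X⟧} {q u v : ℂ} (hf : HasSum (fun n => f.coeff n * q ^ n) u)
    (hg : HasSum (fun n => g.coeff n * q ^ n) v) :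
    HasSum (fun n => (f * g).coeff n * q ^ n) (u * v) := by
  have h := summable_norm_sum_mul_antidiagonal_of_summable_norm hf.summable.norm hg.summable.norm
  have h2 := tsum_mul_tsum_eq_tsum_sum_antidiagonal_of_summable_norm hf.summable.norm
    hg.summable.norm
  rw [hf.tsum_eq, hg.tsum_eq] at h2
  rw [h2]
  have e : (fun n => (f * g).coeff n * q ^ n) = fun n =>
      ∑ kl ∈ Finset.HasAntidiagonal.antidiagonal n,
        f.coeff kl.1 * q ^ kl.1 * (g.coeff kl.2 * q ^ kl.2) := by
    ext n
    rw [PowerSeries.coeff_mul, Finset.sum_mul]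
    refine Finset.sum_congr rfl fun x hx => ?_
    rw [← Finset.HasAntidiagonal.mem_antidiagonal.mp hx, pow_add]
    ring
  rw [e]
  exact h.of_norm.hasSum

/-- The pairs of a power series and its sum at `q`, when it converges there. -/
def seriesGraph (q : ℂ) : Subring (ℂ⟦X⟧ × ℂ) where
  carrier := {x | HasSum (fun n => x.1.coeff n * q ^ n) x.2}
  mul_mem' := hasSum_coeff_mul
  one_mem' := by
    convert hasSum_single (f := fun m : ℕ => (1 : ℂ⟦X⟧).coeff m * q ^ m) 0
      (fun n hn => by rw [PowerSeries.coeff_one, if_neg hn, zero_mul]) using 1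
    simp
  add_mem' {x y} hx hy := by
    simpa [add_mul] using HasSum.add (Set.mem_ofPred.mp hx) (Set.mem_ofPred.mp hy)
  zero_mem' := by simp
  neg_mem' {x} hx := by
    simpa using HasSum.neg (Set.mem_ofPred.mp hx)

lemma mem_seriesGraph {q : ℂ} {x : ℂ⟦X⟧ × ℂ} :
    x ∈ seriesGraph q ↔ HasSum (fun n => x.1.coeff n * q ^ n) x.2 := Iff.rfl

lemma C_mem_seriesGraph (q c : ℂ) : (PowerSeries.C c, c) ∈ seriesGraph q := by
  rw [mem_seriesGraph]
  convert hasSum_single (f := fun m : ℕ => (PowerSeries.C c).coeff m * q ^ m) 0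
    (fun n hn => by rw [PowerSeries.coeff_C, if_neg hn, zero_mul]) using 1
  simp

lemma X_mem_seriesGraph (q : ℂ) : (PowerSeries.X, q) ∈ seriesGraph q := by
  rw [mem_seriesGraph]
  convert hasSum_single (f := fun m : ℕ => (PowerSeries.X : ℂ⟦X⟧).coeff m * q ^ m) 1
    (fun n hn => by rw [PowerSeries.coeff_X, if_neg hn, zero_mul]) using 1
  simp

/-- An integral power series evaluated at a complex number. -/
def HasEval (f : ℤ⟦X⟧) (q v : ℂ) : Prop := (f.map (Int.castRingHom ℂ), v) ∈ seriesGraph q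

lemma hasEval_iff {f : ℤ⟦X⟧} {q v : ℂ} :
    HasEval f q v ↔ HasSum (fun n => (f.coeff n : ℂ) * q ^ n) v := by
  simp [HasEval, mem_seriesGraph]

lemma hasEval_jSeries (τ : ℍ) : HasEval jSeries (qParam 1 τ) (qParam 1 τ * j τ) :=
  hasEval_iff.mpr (hasSum_jSeries τ)

lemma HasEval.sub {f g : ℤ⟦X⟧} {q u v : ℂ} (hf : HasEval f q u) (hg : HasEval g q v) :
    HasEval (f - g) q (u - v) := by
  simpa [HasEval] using sub_mem hf hg

lemma HasEval.mul {f g : ℤ⟦X⟧} {q u v : ℂ} (hf : HasEval f q u) (hg : HasEval g q v) :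
    HasEval (f * g) q (u * v) := by
  simpa [HasEval] using mul_mem hf hg

lemma HasEval.pow {f : ℤ⟦X⟧} {q u : ℂ} (hf : HasEval f q u) (n : ℕ) :
    HasEval (f ^ n) q (u ^ n) := by
  simpa [HasEval] using pow_mem hf n

lemma hasEval_C (q : ℂ) (m : ℤ) : HasEval (PowerSeries.C m) q m := by
  simpa [HasEval] using C_mem_seriesGraph q m

lemma hasEval_X (q : ℂ) : HasEval PowerSeries.X q q := by
  simpa [HasEval] using X_mem_seriesGraph q

lemma HasEval.of_X_mul {f : ℤ⟦X⟧} {q v : ℂ} (hq : q ≠ 0)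
    (h : HasEval (PowerSeries.X * f) q (q * v)) :
    HasEval f q v := by
  rw [hasEval_iff] at h ⊢
  rw [← hasSum_nat_add_iff' 1] at h
  have := h.mul_left q⁻¹
  simp only [Finset.range_one, Finset.sum_singleton, PowerSeries.coeff_succ_X_mul,
    PowerSeries.coeff_zero_X_mul, Int.cast_zero, zero_mul, sub_zero,
    inv_mul_cancel_left₀ hq] at this
  have e : (fun n => (f.coeff n : ℂ) * q ^ n) =
      fun n => q⁻¹ * ((f.coeff n : ℂ) * q ^ (n + 1)) := by
    ext n
    rw [pow_succ, mul_left_comm, mul_left_comm q⁻¹, inv_mul_cancel₀ hq, mul_one]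
  rw [e]
  exact this

/-- An `SL(2, ℤ)`-invariant function whose `q`-expansion has coefficients in an ideal `I` of `ℤ` and
a pole of finite order is a polynomial in `j` with coefficients in `I`. -/
theorem exists_polynomial_j_of_hasEval (I : Ideal ℤ) (M : ℕ) {c : ℍ → ℂ}
    (hc : ∀ (γ : SL(2, ℤ)) τ, c (γ • τ) = c τ) {f : ℤ⟦X⟧} (hf : ∀ n, f.coeff n ∈ I)
    (hs : ∀ τ : ℍ, HasEval f (qParam 1 τ) (qParam 1 τ ^ M * c τ)) :
    ∃ g : ℤ[X], (∀ n, g.coeff n ∈ I) ∧ ∀ τ : ℍ, c τ = eval₂ (Int.castRingHom ℂ) (j τ) g := by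
  induction M generalizing c f with
  | zero =>
    refine ⟨C (f.coeff 0), fun n => ?_, fun τ => ?_⟩
    · rw [coeff_C]
      split_ifs
      exacts [hf 0, I.zero_mem]
    · have hs' (τ : ℍ) : HasSum (fun n => (f.coeff n : ℂ) * qParam 1 τ ^ n) (c τ) := by
        simpa [hasEval_iff] using hs τ
      rw [eval₂_C]
      exact eq_const_of_invariant_of_hasSum hc hs' τ
  | succ M ih =>
    set a := f.coeff 0 with ha
    let f' := f - PowerSeries.C a * jSeries ^ (M + 1)
    have hf'0 : f'.constantCoeff = 0 := by
      simp [f', constantCoeff_jSeries, ha]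
    have hX : f' = PowerSeries.X * PowerSeries.mk fun n => f'.coeff (n + 1) := by
      have := PowerSeries.sub_const_eq_X_mul_shift f'
      rwa [hf'0, _root_.map_zero, sub_zero] at this
    have hf'I (n : ℕ) : f'.coeff n ∈ I := by
      simp only [f', map_sub, PowerSeries.coeff_C_mul]
      exact I.sub_mem (hf n) (I.mul_mem_right _ (hf 0))
    obtain ⟨g, hg, hgc⟩ := ih (c := fun τ => c τ - a * j τ ^ (M + 1))
      (fun γ τ => by rw [hc, j_smul])
      (f := PowerSeries.mk fun n => f'.coeff (n + 1))
      (fun n => by rw [PowerSeries.coeff_mk]; exact hf'I _)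
      (fun τ => by
        refine HasEval.of_X_mul (qParam_ne_zero (h := 1) _) ?_
        rw [← hX]
        convert (hs τ).sub ((hasEval_C _ a).mul ((hasEval_jSeries τ).pow (M + 1))) using 1
        ring)
    refine ⟨g + C a * X ^ (M + 1), fun n => ?_, fun τ => ?_⟩
    · rw [coeff_add, coeff_C_mul]
      exact I.add_mem (hg n) (I.mul_mem_right _ (hf 0))
    · rw [eval₂_add, ← hgc τ, eval₂_mul, eval₂_C, eval₂_X_pow, eq_intCast]
      ring

lemma infinite_range_j : (Set.range fun τ : ℍ => j τ).Infinite := by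
  intro hfin
  obtain ⟨B, hB⟩ := hfin.isBounded.exists_norm_le
  have h1 : Filter.Tendsto (fun τ : ℍ => qParam 1 τ * j τ) atImInfty (𝓝 0) := by
    refine squeeze_zero_norm (a := fun τ : ℍ => ‖qParam 1 τ‖ * B) (fun τ => ?_) ?_
    · rw [norm_mul]
      exact mul_le_mul_of_nonneg_left (hB _ ⟨τ, rfl⟩) (norm_nonneg _)
    · simpa using (qParam_tendsto_atImInfty one_pos).norm.mul_const B
  have h2 := qExpansion_coeff_zero one_pos analyticAt_cuspFunction_qParam_mul_j
    periodic_qParam_mul_j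
  rw [IsZeroAtImInfty.valueAtInfty_eq_zero h1, ← map_jSeries, PowerSeries.coeff_map,
    PowerSeries.coeff_zero_eq_constantCoeff_apply, constantCoeff_jSeries] at h2
  simp at h2

lemma eq_of_eval₂_j_eq {f g : ℤ[X]} (h : ∀ τ : ℍ, eval₂ (Int.castRingHom ℂ) (j τ) f =
    eval₂ (Int.castRingHom ℂ) (j τ) g) : f = g := by
  refine map_injective (Int.castRingHom ℂ) Int.cast_injective (eq_of_infinite_eval_eq _ _ ?_)
  refine infinite_range_j.mono ?_
  rintro _ ⟨τ, rfl⟩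
  simpa [eval_map] using h τ

end

noncomputable section

open MatrixGroups

/-- An integer matrix is primitive if its entries have no common non-unit divisor. -/
def IsPrimitiveMatrix (M : Matrix (Fin 2) (Fin 2) ℤ) : Prop :=
  ∀ n : ℤ, (∀ i k, n ∣ M i k) → IsUnit n

lemma dvd_mul_entries {n : ℤ} {M : Matrix (Fin 2) (Fin 2) ℤ} (h : ∀ i k, n ∣ M i k)
    (A B : Matrix (Fin 2) (Fin 2) ℤ) (i k : Fin 2) : n ∣ (A * M * B) i k := by
  rw [Matrix.mul_apply]
  refine Finset.dvd_sum fun x _ => Dvd.dvd.mul_right ?_ _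
  rw [Matrix.mul_apply]
  exact Finset.dvd_sum fun y _ => Dvd.dvd.mul_left (h _ _) _

lemma IsPrimitiveMatrix.mul_mul {M : Matrix (Fin 2) (Fin 2) ℤ} (hM : IsPrimitiveMatrix M)
    (γ δ : SL(2, ℤ)) : IsPrimitiveMatrix (γ.1 * M * δ.1) := by
  intro n hn
  refine hM n ?_
  have := dvd_mul_entries hn (γ⁻¹).1 (δ⁻¹).1
  have e : (γ⁻¹).1 * (γ.1 * M * δ.1) * (δ⁻¹).1 = M := by
    have h1 : (γ⁻¹).1 * γ.1 = 1 := congrArg Subtype.val (inv_mul_cancel γ)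
    have h2 : δ.1 * (δ⁻¹).1 = 1 := congrArg Subtype.val (mul_inv_cancel δ)
    rw [mul_assoc γ.1, ← mul_assoc, h1, one_mul, mul_assoc, h2, mul_one]
  rwa [e] at this

lemma mem_reps_iff_isPrimitiveMatrix {s : ℕ} (hs : 0 < s) (S : Matrix (Fin 2) (Fin 2) ℤ) :
    S ∈ reps s ↔ S 1 0 = 0 ∧ 0 < S 0 0 ∧ S 0 0 * S 1 1 = s ∧ 0 ≤ S 0 1 ∧ S 0 1 < S 1 1 ∧
      IsPrimitiveMatrix S := by
  rw [mem_reps hs]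
  refine and_congr_right fun h0 => and_congr_right fun _ => and_congr_right fun _ =>
    and_congr_right fun _ => and_congr_right fun _ => ⟨fun h n hn => ?_, fun h => ?_⟩
  · have h1 : n ∣ (Int.gcd (Int.gcd (S 0 0) (S 0 1)) (S 1 1) : ℤ) :=
      Int.dvd_coe_gcd (Int.dvd_coe_gcd (hn 0 0) (hn 0 1)) (hn 1 1)
    rw [h] at h1
    exact isUnit_of_dvd_one (by exact_mod_cast h1)
  · have := h (Int.gcd (Int.gcd (S 0 0) (S 0 1)) (S 1 1)) (by
      have h1 := Int.gcd_dvd_left (a := (Int.gcd (S 0 0) (S 0 1) : ℤ)) (b := S 1 1)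
      have h2 := Int.gcd_dvd_right (a := (Int.gcd (S 0 0) (S 0 1) : ℤ)) (b := S 1 1)
      intro i k
      fin_cases i <;> fin_cases k
      · exact h1.trans (Int.gcd_dvd_left ..)
      · exact h1.trans (Int.gcd_dvd_right ..)
      · simp [h0]
      · exact h2)
    simpa [Int.isUnit_iff] using this

lemma det_of_mem_reps {s : ℕ} (hs : 0 < s) {S : Matrix (Fin 2) (Fin 2) ℤ} (hS : S ∈ reps s) :
    S.det = s := by
  obtain ⟨h0, -, h1, -⟩ := (mem_reps hs S).mp hS
  rw [Matrix.det_fin_two, h0, h1]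
  ring

lemma exists_mul_mem_reps {s : ℕ} (hs : 0 < s) {M : Matrix (Fin 2) (Fin 2) ℤ} (hdet : M.det = s)
    (hM : IsPrimitiveMatrix M) : ∃ S ∈ reps s, ∃ γ : SL(2, ℤ), M = γ.1 * S := by
  have key : ∃ (S : Matrix (Fin 2) (Fin 2) ℤ) (γ : SL(2, ℤ)), (S 1 0 = 0 ∧ 0 < S 0 0 ∧
      0 ≤ S 0 1 ∧ |S 0 1| < |S 1 1|) ∧ M = γ.1 * S := by
    have hs' : (s : ℤ) ≠ 0 := by exact_mod_cast hs.ne'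
    refine FixedDetMatrices.induction_on (A := (⟨M, hdet⟩ : FixedDetMatrix (Fin 2) ℤ (s : ℤ)))
      (C := fun A => ∃ (S : Matrix (Fin 2) (Fin 2) ℤ) (γ : SL(2, ℤ)), (S 1 0 = 0 ∧ 0 < S 0 0 ∧
      0 ≤ S 0 1 ∧ |S 0 1| < |S 1 1|) ∧ A.1 = γ.1 * S) hs' ?_ ?_ ?_
    · intro A h1 h2 h3 h4
      exact ⟨A.1, 1, ⟨h1, h2, h3, h4⟩, by simp⟩
    · rintro B ⟨S, γ, h, e⟩
      exact ⟨S, ModularGroup.S * γ, h, by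
        rw [FixedDetMatrices.smul_coe, e, ← mul_assoc]; rfl⟩
    · rintro B ⟨S, γ, h, e⟩
      exact ⟨S, ModularGroup.T * γ, h, by
        rw [FixedDetMatrices.smul_coe, e, ← mul_assoc]; rfl⟩
  obtain ⟨S, γ, ⟨h0, ha, hb, hbd⟩, e⟩ := key
  have hS : S = (γ⁻¹).1 * M * (1 : SL(2, ℤ)).1 := by
    have h1 : (γ⁻¹).1 * γ.1 = 1 := congrArg Subtype.val (inv_mul_cancel γ)
    rw [e, ← mul_assoc, h1, one_mul]
    simp
  have hd : S 0 0 * S 1 1 = s := by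
    have : S.det = s := by
      rw [← hdet, e, Matrix.det_mul, γ.2, one_mul]
    rw [Matrix.det_fin_two, h0] at this
    linarith
  have hd1 : 0 < S 1 1 := by
    have : (0 : ℤ) < s := by exact_mod_cast hs
    rw [← hd] at this
    exact (pos_iff_pos_of_mul_pos this).mp ha
  rw [abs_of_nonneg hb, abs_of_pos hd1] at hbd
  refine ⟨S, (mem_reps_iff_isPrimitiveMatrix hs S).mpr ⟨h0, ha, hd, hb, hbd, ?_⟩, γ, e⟩
  rw [hS]
  exact hM.mul_mul _ _

lemma eq_of_mul_eq_of_mem_reps {s : ℕ} (hs : 0 < s) {S S' : Matrix (Fin 2) (Fin 2) ℤ}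
    (hS : S ∈ reps s) (hS' : S' ∈ reps s) {γ : SL(2, ℤ)} (h : S' = γ.1 * S) : S' = S := by
  obtain ⟨h0, ha, hd, hb, hbd, -⟩ := (mem_reps hs S).mp hS
  obtain ⟨h0', ha', hd', hb', hbd', -⟩ := (mem_reps hs S').mp hS'
  have e (i k : Fin 2) : S' i k = γ.1 i 0 * S 0 k + γ.1 i 1 * S 1 k := by
    rw [h, Matrix.mul_apply, Fin.sum_univ_two]
  have hdet := γ.2
  rw [Matrix.det_fin_two] at hdet
  have e10 := e 1 0
  rw [h0', h0, mul_zero, add_zero, eq_comm] at e10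
  have g10 : γ.1 1 0 = 0 := (mul_eq_zero.mp e10).resolve_right ha.ne'
  rw [g10, mul_zero, sub_zero] at hdet
  have e00 := e 0 0
  rw [h0, mul_zero, add_zero] at e00
  have g00 : γ.1 0 0 = 1 := by
    rcases Int.mul_eq_one_iff_eq_one_or_neg_one.mp hdet with h | h
    · exact h.1
    · rw [h.1] at e00
      linarith
  rw [g00, one_mul] at hdet e00
  have e11 := e 1 1
  rw [g10, hdet, zero_mul, zero_add, one_mul] at e11
  have e01 := e 0 1
  rw [g00, one_mul] at e01
  have g01 : γ.1 0 1 = 0 := by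
    rw [e01] at hb' hbd'
    rw [e11] at hbd'
    by_contra hne
    rcases lt_or_gt_of_ne hne with h | h <;> nlinarith
  rw [g01, zero_mul, add_zero] at e01
  ext i k
  fin_cases i <;> fin_cases k
  · exact e00
  · exact e01
  · exact h0'.trans h0.symm
  · exact e11

/-- An integer matrix of positive determinant as an element of `GL(2, ℝ)`. -/
def toGLReal (S : Matrix (Fin 2) (Fin 2) ℤ) (hS : 0 < S.det) : GL (Fin 2) ℝ :=
  Matrix.GeneralLinearGroup.mkOfDetNeZero (S.map (Int.cast : ℤ → ℝ)) (by
    have : (S.map (Int.cast : ℤ → ℝ)).det = (S.det : ℝ) :=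
      ((Int.castRingHom ℝ).map_det S).symm
    rw [this]
    exact_mod_cast hS.ne')

lemma coe_toGLReal_smul {S : Matrix (Fin 2) (Fin 2) ℤ} (hS : 0 < S.det) (τ : ℍ) :
    ((toGLReal S hS • τ : ℍ) : ℂ) = moebius S τ := by
  have : (S.map (Int.cast : ℤ → ℝ)).det = (S.det : ℝ) := ((Int.castRingHom ℝ).map_det S).symm
  rw [coe_smul_of_det_pos]
  · simp [num, denom, toGLReal, moebius, Matrix.GeneralLinearGroup.mkOfDetNeZero]
  · change 0 < (S.map (Int.cast : ℤ → ℝ)).det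
    rw [this]
    exact_mod_cast hS

lemma j_moebius_smul {S S' : Matrix (Fin 2) (Fin 2) ℤ} (hS : 0 < S.det) (hS' : 0 < S'.det)
    {γ γ' : SL(2, ℤ)} (h : S * γ.1 = γ'.1 * S') (τ : ℍ) :
    j (moebius S (γ • τ : ℍ)) = j (moebius S' τ) := by
  rw [← coe_toGLReal_smul hS, ← coe_toGLReal_smul hS', ← j_smul γ' (toGLReal S' hS' • τ)]
  have key : toGLReal S hS * Matrix.SpecialLinearGroup.mapGL ℝ γ =
      Matrix.SpecialLinearGroup.mapGL ℝ γ' * toGLReal S' hS' := by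
    apply Units.ext
    change S.map (Int.castRingHom ℝ) * γ.1.map (Int.castRingHom ℝ) =
      γ'.1.map (Int.castRingHom ℝ) * S'.map (Int.castRingHom ℝ)
    rw [← Matrix.map_mul, ← Matrix.map_mul, h]
  congr 2
  change toGLReal S hS • Matrix.SpecialLinearGroup.mapGL ℝ γ • τ =
    Matrix.SpecialLinearGroup.mapGL ℝ γ' • toGLReal S' hS' • τ
  rw [← mul_smul, key, mul_smul]

theorem principalPoly_smul {s : ℕ} (hs : 0 < s) (γ : SL(2, ℤ)) (τ : ℍ) :
    principalPoly s (γ • τ : ℍ) = principalPoly s τ := by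
  have hdet {S : Matrix (Fin 2) (Fin 2) ℤ} (hS : S ∈ reps s) : 0 < S.det := by
    rw [det_of_mem_reps hs hS]
    exact_mod_cast hs
  have hex : ∀ S ∈ reps s, ∃ S' ∈ reps s, ∃ γ' : SL(2, ℤ), S * γ.1 = γ'.1 * S' := by
    intro S hS
    refine exists_mul_mem_reps hs ?_ ?_
    · rw [Matrix.det_mul, γ.2, mul_one, det_of_mem_reps hs hS]
    · have := (((mem_reps_iff_isPrimitiveMatrix hs S).mp hS).2.2.2.2.2).mul_mul 1 γ
      simpa using this
  choose! f hf g hg using hex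
  have hinj : Set.InjOn f (reps s) := by
    intro S hS T hT hST
    have h1 := hg S hS
    have h2 := hg T hT
    rw [← hST] at h2
    refine (eq_of_mul_eq_of_mem_reps hs hT hS (γ := g S * (g T)⁻¹) ?_)
    have e1 : γ.1 * (γ⁻¹).1 = 1 := congrArg Subtype.val (mul_inv_cancel γ)
    have e2 : ((g T)⁻¹).1 * (g T).1 = 1 := congrArg Subtype.val (inv_mul_cancel (g T))
    have e3 : f S = ((g T)⁻¹).1 * (T * γ.1) := by rw [h2, ← mul_assoc, e2, one_mul]
    calc S = S * γ.1 * (γ⁻¹).1 := by rw [mul_assoc, e1, mul_one]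
      _ = (g S).1 * (((g T)⁻¹).1 * (T * γ.1)) * (γ⁻¹).1 := by rw [h1, ← e3]
      _ = (g S).1 * ((g T)⁻¹).1 * T * (γ.1 * (γ⁻¹).1) := by simp only [mul_assoc]
      _ = _ := by rw [e1, mul_one]; rfl
  have hmaps : Set.MapsTo f (reps s) (reps s) := fun S hS => hf S hS
  refine Finset.prod_nbij f (fun S hS => hf S hS) hinj
    (Finset.surjOn_of_injOn_of_card_le f hmaps hinj le_rfl) fun S hS => ?_
  rw [j_moebius_smul (hdet hS) (hdet (hf S hS)) (hg S hS)]

end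

noncomputable section

open MatrixGroups Function.Periodic
open scoped PowerSeries

/-- An integral polynomial taking the same value at all primitive `s`-th roots of unity is congruent
to an integer modulo the cyclotomic polynomial. -/
lemma exists_cyclotomic_dvd_sub_C {s : ℕ} (hs : 0 < s) {h : ℤ[X]} {c : ℂ}
    (hc : ∀ z : ℂ, IsPrimitiveRoot z s → eval₂ (Int.castRingHom ℂ) z h = c) :
    ∃ m : ℤ, cyclotomic s ℤ ∣ h - C m := by
  have hmon := cyclotomic.monic s ℤ
  set r := h %ₘ cyclotomic s ℤ with hr
  have hdeg : r.degree < s.totient := by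
    have := degree_modByMonic_lt h hmon
    rwa [degree_cyclotomic] at this
  have hroot (z : ℂ) (hz : IsPrimitiveRoot z s) : eval₂ (Int.castRingHom ℂ) z r = c := by
    have h0 : eval₂ (Int.castRingHom ℂ) z (cyclotomic s ℤ) = 0 := by
      rw [← eval_map, map_cyclotomic]
      exact hz.isRoot_cyclotomic hs
    rw [← hc z hz]
    conv_rhs => rw [← modByMonic_add_div h (cyclotomic s ℤ)]
    rw [eval₂_add, eval₂_mul, h0, zero_mul, add_zero]
  have hzero : r.map (Int.castRingHom ℂ) - C c = 0 := by
    refine eq_zero_of_degree_lt_of_eval_finset_eq_zero (primitiveRoots s ℂ) ?_ fun z hz => ?_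
    · rw [Complex.card_primitiveRoots]
      refine (degree_sub_le _ _).trans_lt (max_lt (degree_map_le.trans_lt hdeg) ?_)
      exact degree_C_le.trans_lt (by exact_mod_cast Nat.totient_pos.mpr hs)
    · rw [eval_sub, eval_C, eval_map, hroot z ((mem_primitiveRoots hs).mp hz), sub_self]
  have hrC : r = C (r.coeff 0) := by
    refine map_injective (Int.castRingHom ℂ) Int.cast_injective ?_
    have h1 := sub_eq_zero.mp hzero
    have h2 := congrArg (fun p => coeff p 0) h1
    simp only [coeff_map, coeff_C_zero] at h2
    rw [map_C, h2, h1]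
  refine ⟨r.coeff 0, h /ₘ cyclotomic s ℤ, ?_⟩
  rw [← hrC]
  linear_combination -modByMonic_add_div h (cyclotomic s ℤ)

/-- The power series `f (c X ^ m)` for `m > 0`. -/
def substMonomial {R : Type*} [CommRing R] (m : ℕ) (c : R) (f : R⟦X⟧) : R⟦X⟧ :=
  PowerSeries.mk fun n => if m ∣ n then f.coeff (n / m) * c ^ (n / m) else 0

lemma map_substMonomial {R S : Type*} [CommRing R] [CommRing S] (φ : R →+* S) (m : ℕ) (c : R)
    (f : R⟦X⟧) : (substMonomial m c f).map φ = substMonomial m (φ c) (f.map φ) := by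
  ext n
  simp only [substMonomial, PowerSeries.coeff_map, PowerSeries.coeff_mk]
  split_ifs <;> simp

lemma substMonomial_mem_seriesGraph {f : ℂ⟦X⟧} {m : ℕ} (hm : 0 < m) {c q v : ℂ}
    (h : HasSum (fun n => f.coeff n * (c * q ^ m) ^ n) v) :
    (substMonomial m c f, v) ∈ seriesGraph q := by
  rw [mem_seriesGraph, ← (mul_right_injective₀ hm.ne').hasSum_iff]
  · convert h using 1
    ext n
    simp only [Function.comp_apply, substMonomial, PowerSeries.coeff_mk, dvd_mul_right, if_true,
      Nat.mul_div_cancel_left n hm]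
    rw [mul_pow, pow_mul, mul_assoc]
  · intro n hn
    have : ¬ m ∣ n := fun ⟨k, hk⟩ => hn ⟨k, hk.symm⟩
    simp [substMonomial, this]

lemma zero_zero_mem_seriesGraph (q : ℂ) : (0, 0) ∈ seriesGraph q := (seriesGraph q).zero_mem

lemma one_one_mem_seriesGraph (q : ℂ) : (1, 1) ∈ seriesGraph q := (seriesGraph q).one_mem

/-- Pairs of a polynomial over power series and its value at `q`. -/
def polySeriesGraph (q : ℂ) : Subring (ℂ⟦X⟧[X] × ℂ[X]) where
  carrier := {x | ∀ k, (x.1.coeff k, x.2.coeff k) ∈ seriesGraph q}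
  mul_mem' {x y} hx hy k := by
    have e : ((x * y).1.coeff k, (x * y).2.coeff k) =
        ∑ a ∈ Finset.HasAntidiagonal.antidiagonal k,
          (x.1.coeff a.1, x.2.coeff a.1) * (y.1.coeff a.2, y.2.coeff a.2) := by
      ext1
      · simp [coeff_mul, Prod.fst_sum]
      · simp [coeff_mul, Prod.snd_sum]
    rw [e]
    exact sum_mem fun a _ => mul_mem (hx a.1) (hy a.2)
  one_mem' k := by
    by_cases hk : k = 0
    · subst hk
      simp [one_one_mem_seriesGraph]
    · simp [coeff_one, hk, zero_zero_mem_seriesGraph]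
  add_mem' {x y} hx hy k := by simpa using add_mem (hx k) (hy k)
  zero_mem' k := by simp [zero_zero_mem_seriesGraph]
  neg_mem' {x} hx k := by simpa using neg_mem (hx k)

lemma C_mem_polySeriesGraph {q v : ℂ} {f : ℂ⟦X⟧} (h : (f, v) ∈ seriesGraph q) :
    (C f, C v) ∈ polySeriesGraph q := by
  intro k
  by_cases hk : k = 0
  · subst hk
    simpa using h
  · simp [coeff_C, hk, zero_zero_mem_seriesGraph]

lemma X_mem_polySeriesGraph (q : ℂ) : (X, X) ∈ polySeriesGraph q := by
  intro k
  by_cases hk : k = 1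
  · subst hk
    simp [one_one_mem_seriesGraph]
  · simp [coeff_X, Ne.symm hk, zero_zero_mem_seriesGraph]

/-- The factor `Q ^ m X - w⁻¹ f (w Q ^ m)` for `f = q j` and `w ^ s = 1`. -/
def levelFactor {R : Type*} [CommRing R] (s m : ℕ) (w : R) : R⟦X⟧[X] :=
  C (PowerSeries.X ^ m) * X -
    C (PowerSeries.C (w ^ (s - 1)) * substMonomial m w (jSeries.map (Int.castRingHom R)))

/-- The formal principal polynomial of level `s`, with denominators in `Q = q ^ (1 / s)` cleared, for
the choice `z` of a root of unity of order `s`. -/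
def levelPoly {R : Type*} [CommRing R] (s : ℕ) (z : R) : R⟦X⟧[X] :=
  ∏ S ∈ reps s, levelFactor s ((S 0 0).toNat ^ 2) (z ^ ((S 0 0).toNat * (S 0 1).toNat))

lemma map_levelFactor {R S : Type*} [CommRing R] [CommRing S] (φ : R →+* S) (s m : ℕ) (w : R) :
    (levelFactor s m w).map (PowerSeries.map φ) = levelFactor s m (φ w) := by
  have h : (jSeries.map (Int.castRingHom R)).map φ = jSeries.map (Int.castRingHom S) := by
    ext n
    simp
  simp [levelFactor, map_substMonomial, h]

lemma map_levelPoly {R S : Type*} [CommRing R] [CommRing S] (φ : R →+* S) (s : ℕ) (z : R) :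
    (levelPoly s z).map (PowerSeries.map φ) = levelPoly s (φ z) := by
  simp [levelPoly, Polynomial.map_prod, map_levelFactor]

lemma exists_nat_of_mem_reps {s : ℕ} {S : Matrix (Fin 2) (Fin 2) ℤ} (hS : S ∈ reps s) :
    ∃ a b d : ℕ, a * d = s ∧ b < d ∧ Nat.gcd (Nat.gcd a b) d = 1 ∧
      S = !![(a : ℤ), (b : ℤ); 0, (d : ℤ)] := by
  simp only [reps, Finset.mem_image, Finset.mem_filter, Prod.exists] at hS
  obtain ⟨a, b, d, ⟨-, h1, h2, h3⟩, rfl⟩ := hS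
  exact ⟨a, b, d, h1, h2, h3, rfl⟩

lemma nat_mem_reps {s : ℕ} (hs : 0 < s) {a b d : ℕ} (had : a * d = s) (hbd : b < d)
    (hg : Nat.gcd (Nat.gcd a b) d = 1) : !![(a : ℤ), (b : ℤ); 0, (d : ℤ)] ∈ reps s := by
  have ha : 0 < a := Nat.pos_of_mul_pos_right (had ▸ hs)
  rw [mem_reps hs]
  refine ⟨by simp, by simpa using ha, by simp [← had], by simp, by simpa using hbd, ?_⟩
  simpa using hg

lemma levelPoly_pow_of_coprime {s u : ℕ} (hs : 0 < s) (hu : u.Coprime s) {R : Type*} [CommRing R]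
    {z : R} (hz : z ^ s = 1) : levelPoly s (z ^ u) = levelPoly s z := by
  let f : Matrix (Fin 2) (Fin 2) ℤ → Matrix (Fin 2) (Fin 2) ℤ :=
    fun S => !![S 0 0, (u * S 0 1) % S 1 1; 0, S 1 1]
  have hf (a b d : ℕ) : f !![(a : ℤ), (b : ℤ); 0, (d : ℤ)] =
      !![(a : ℤ), ((u * b % d : ℕ) : ℤ); 0, (d : ℤ)] := by
    simp [f]
  have hmaps : Set.MapsTo f (reps s) (reps s) := by
    intro S hS
    obtain ⟨a, b, d, had, hbd, hg, rfl⟩ := exists_nat_of_mem_reps hS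
    rw [hf]
    refine nat_mem_reps hs had (Nat.mod_lt _ (by omega)) ?_
    set n := Nat.gcd (Nat.gcd a (u * b % d)) d with hn
    have h1 : n ∣ a := (Nat.gcd_dvd_left _ _).trans (Nat.gcd_dvd_left _ _)
    have h2 : n ∣ u * b % d := (Nat.gcd_dvd_left _ _).trans (Nat.gcd_dvd_right _ _)
    have h3 : n ∣ d := Nat.gcd_dvd_right _ _
    have h4 : n ∣ u * b := (Nat.dvd_mod_iff h3).mp h2
    have h5 : n.Coprime u := (hu.symm.coprime_dvd_left (had ▸ h3.mul_left a))
    exact Nat.dvd_one.mp (hg ▸ Nat.dvd_gcd (Nat.dvd_gcd h1 (h5.dvd_of_dvd_mul_left h4)) h3)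
  have hinj : Set.InjOn f (reps s) := by
    intro S hS T hT hST
    obtain ⟨a, b, d, had, hbd, hg, rfl⟩ := exists_nat_of_mem_reps hS
    obtain ⟨a', b', d', had', hbd', hg', rfl⟩ := exists_nat_of_mem_reps hT
    rw [hf, hf] at hST
    have e1 : a = a' := by simpa using congrFun₂ hST 0 0
    have e2 : d = d' := by simpa using congrFun₂ hST 1 1
    have e3 : ((u * b % d : ℕ) : ℤ) = ((u * b' % d' : ℕ) : ℤ) := congrFun₂ hST 0 1
    replace e3 : u * b % d = u * b' % d' := by exact_mod_cast e3
    subst e1 e2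
    have h5 : d.gcd u = 1 := (hu.symm.coprime_dvd_left (had ▸ Dvd.intro_left a rfl))
    have h6 : b = b' := Nat.ModEq.eq_of_lt_of_lt (Nat.ModEq.cancel_left_of_coprime h5 e3) hbd hbd'
    rw [h6]
  refine Finset.prod_nbij f (fun S hS => hmaps hS) hinj
    (Finset.surjOn_of_injOn_of_card_le f hmaps hinj le_rfl) fun S hS => ?_
  obtain ⟨a, b, d, had, hbd, hg, rfl⟩ := exists_nat_of_mem_reps hS
  rw [hf]
  have e : (z ^ u) ^ (a * b) = z ^ (a * (u * b % d)) := by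
    have h := Nat.div_add_mod (u * b) d
    calc (z ^ u) ^ (a * b) = z ^ (a * (u * b)) := by rw [← pow_mul]; ring_nf
      _ = z ^ (a * (d * (u * b / d) + u * b % d)) := by rw [h]
      _ = (z ^ (a * d)) ^ (u * b / d) * z ^ (a * (u * b % d)) := by
        rw [mul_add, pow_add, ← pow_mul]; ring_nf
      _ = _ := by rw [had, hz, one_pow, one_mul]
  change levelFactor s ((a : ℤ).toNat ^ 2) ((z ^ u) ^ ((a : ℤ).toNat * (b : ℤ).toNat)) =
    levelFactor s ((a : ℤ).toNat ^ 2) (z ^ ((a : ℤ).toNat * ((u * b % d : ℕ) : ℤ).toNat))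
  simp only [Int.toNat_natCast, e]

lemma qParam_moebius {s : ℕ} (hs : 0 < s) {S : Matrix (Fin 2) (Fin 2) ℤ} (hS : S ∈ reps s)
    (τ : ℍ) : qParam 1 (moebius S τ) = Complex.exp (2 * Real.pi * Complex.I / s) ^
      ((S 0 0).toNat * (S 0 1).toNat) * qParam s τ ^ ((S 0 0).toNat ^ 2) := by
  obtain ⟨a, b, d, had, hbd, hg, rfl⟩ := exists_nat_of_mem_reps hS
  have ha : (a : ℂ) ≠ 0 := by
    exact_mod_cast (Nat.pos_of_mul_pos_right (had ▸ hs)).ne'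
  have hd : (d : ℂ) ≠ 0 := by exact_mod_cast (by omega : d ≠ 0)
  subst had
  simp only [qParam, moebius, ← Complex.exp_nat_mul, ← Complex.exp_add]
  congr 1
  simp
  field_simp
  ring

lemma exists_coe_eq_moebius {s : ℕ} (hs : 0 < s) {S : Matrix (Fin 2) (Fin 2) ℤ} (hS : S ∈ reps s)
    (τ : ℍ) : ∃ τ' : ℍ, (τ' : ℂ) = moebius S τ :=
  ⟨_, coe_toGLReal_smul (S := S) (by rw [det_of_mem_reps hs hS]; exact_mod_cast hs) τ⟩

/-- The formal principal polynomial evaluates to the principal polynomial times a power of `Q`. -/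
theorem levelPoly_mem_polySeriesGraph {s : ℕ} (hs : 0 < s) (τ : ℍ) :
    (levelPoly s (Complex.exp (2 * Real.pi * Complex.I / s)),
      C (qParam s τ ^ (∑ S ∈ reps s, (S 0 0).toNat ^ 2)) * principalPoly s τ) ∈
      polySeriesGraph (qParam s τ) := by
  set z := Complex.exp (2 * Real.pi * Complex.I / s)
  have hz : z ^ s = 1 := (Complex.isPrimitiveRoot_exp s hs.ne').pow_eq_one
  set Q := qParam s τ
  have e : (levelPoly s z, C (Q ^ (∑ S ∈ reps s, (S 0 0).toNat ^ 2)) * principalPoly s τ) =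
      ∏ S ∈ reps s, (levelFactor s ((S 0 0).toNat ^ 2) (z ^ ((S 0 0).toNat * (S 0 1).toNat)),
        C (Q ^ ((S 0 0).toNat ^ 2)) * X - C (Q ^ ((S 0 0).toNat ^ 2) * j (moebius S τ))) := by
    ext1
    · rw [Prod.fst_prod]
      rfl
    · rw [Prod.snd_prod, principalPoly, ← Finset.prod_pow_eq_pow_sum, map_prod,
        ← Finset.prod_mul_distrib]
      refine Finset.prod_congr rfl fun S _ => ?_
      rw [C_mul]
      ring
  rw [e]
  refine prod_mem fun S hS => ?_
  set m := (S 0 0).toNat ^ 2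
  set w := z ^ ((S 0 0).toNat * (S 0 1).toNat)
  have hm : 0 < m := by
    have := ((mem_reps hs S).mp hS).2.1
    exact pow_pos (by omega) 2
  have hw : w ^ (s - 1) * w = 1 := by
    rw [← pow_succ, Nat.sub_add_cancel hs, ← pow_mul, mul_comm, pow_mul, hz, one_pow]
  have hX : (PowerSeries.X ^ m, Q ^ m) ∈ seriesGraph Q := pow_mem (X_mem_seriesGraph Q) m
  have hsub : (substMonomial m w (jSeries.map (Int.castRingHom ℂ)), w * Q ^ m * j (moebius S τ)) ∈
      seriesGraph Q := by
    refine substMonomial_mem_seriesGraph hm ?_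
    obtain ⟨τ', hτ'⟩ := exists_coe_eq_moebius hs hS τ
    have := hasSum_jSeries τ'
    rw [hτ', qParam_moebius hs hS] at this
    simpa using this
  have hj : (PowerSeries.C (w ^ (s - 1)) * substMonomial m w (jSeries.map (Int.castRingHom ℂ)),
      Q ^ m * j (moebius S τ)) ∈ seriesGraph Q := by
    convert mul_mem (C_mem_seriesGraph Q (w ^ (s - 1))) hsub using 1
    rw [Prod.mk_mul_mk, ← mul_assoc, ← mul_assoc, hw, one_mul]
  have h := sub_mem (mul_mem (C_mem_polySeriesGraph hX) (X_mem_polySeriesGraph Q))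
    (C_mem_polySeriesGraph hj)
  rw [Prod.mk_mul_mk, Prod.mk_sub_mk] at h
  exact h

/-- The coefficients of the formal principal polynomial are integral. -/
lemma exists_cyclotomic_dvd_levelPoly {s : ℕ} (hs : 0 < s) (k : ℕ) :
    ∃ f : ℤ⟦X⟧, ∀ n, cyclotomic s ℤ ∣
      ((levelPoly s (X : ℤ[X])).coeff k).coeff n - C (f.coeff n) := by
  have h (n : ℕ) : ∃ m : ℤ, cyclotomic s ℤ ∣
      ((levelPoly s (X : ℤ[X])).coeff k).coeff n - C m := by
    have hz := Complex.isPrimitiveRoot_exp s hs.ne'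
    refine exists_cyclotomic_dvd_sub_C hs
      (c := ((levelPoly s (Complex.exp (2 * Real.pi * Complex.I / s))).coeff k).coeff n)
      fun z' hz' => ?_
    have : NeZero s := ⟨hs.ne'⟩
    obtain ⟨u, -, hu, rfl⟩ := hz.isPrimitiveRoot_iff.mp hz'
    rw [← levelPoly_pow_of_coprime hs hu hz.pow_eq_one]
    have := map_levelPoly (eval₂RingHom (Int.castRingHom ℂ)
      (Complex.exp (2 * Real.pi * Complex.I / s) ^ u)) s X
    rw [coe_eval₂RingHom, eval₂_X] at this
    rw [← this, coeff_map, PowerSeries.coeff_map, coe_eval₂RingHom]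
  choose f hf using h
  exact ⟨PowerSeries.mk f, fun n => by simpa using hf n⟩

lemma hasEval_of_cyclotomic_dvd {s : ℕ} (hs : 0 < s) {k : ℕ} {f : ℤ⟦X⟧}
    (hf : ∀ n, cyclotomic s ℤ ∣ ((levelPoly s (X : ℤ[X])).coeff k).coeff n - C (f.coeff n))
    (τ : ℍ) : HasEval f (qParam s τ)
      (qParam s τ ^ (∑ S ∈ reps s, (S 0 0).toNat ^ 2) * (principalPoly s τ).coeff k) := by
  have h := levelPoly_mem_polySeriesGraph hs τ k
  simp only [coeff_C_mul] at h
  rw [HasEval]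
  convert h using 2
  ext n
  set z := Complex.exp (2 * Real.pi * Complex.I / s)
  have hz : IsPrimitiveRoot z s := Complex.isPrimitiveRoot_exp s hs.ne'
  have := map_levelPoly (eval₂RingHom (Int.castRingHom ℂ) z) s X
  rw [coe_eval₂RingHom, eval₂_X] at this
  rw [← this, coeff_map, PowerSeries.coeff_map, PowerSeries.coeff_map, coe_eval₂RingHom]
  obtain ⟨g, hg⟩ := hf n
  have h0 : eval₂ (Int.castRingHom ℂ) z (cyclotomic s ℤ) = 0 := by
    rw [← eval_map, map_cyclotomic]
    exact hz.isRoot_cyclotomic hs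
  have := congrArg (eval₂ (Int.castRingHom ℂ) z) hg
  rw [eval₂_sub, eval₂_mul, h0, zero_mul, eval₂_C, sub_eq_zero] at this
  exact this.symm

end

noncomputable section

open MatrixGroups Function.Periodic
open scoped PowerSeries

lemma qParam_pow_self {s : ℕ} (hs : 0 < s) (τ : ℂ) : qParam s τ ^ s = qParam 1 τ := by
  have : (s : ℂ) ≠ 0 := by exact_mod_cast hs.ne'
  rw [qParam, qParam, ← Complex.exp_nat_mul]
  congr 1
  push_cast
  field_simp

lemma qParam_vadd_one (s : ℕ) (τ : ℍ) : qParam s (((1 : ℝ) +ᵥ τ : ℍ) : ℂ) =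
    Complex.exp (2 * Real.pi * Complex.I / s) * qParam s τ := by
  rw [coe_vadd, qParam, qParam, ← Complex.exp_add]
  congr 1
  push_cast
  ring

/-- A function of period one with an expansion in `q ^ (1 / s)` has an expansion in `q`. -/
lemma exists_hasEval_qParam_one {s : ℕ} (hs : 0 < s) (I : Ideal ℤ) {N : ℕ} {c : ℍ → ℂ}
    (hc : ∀ τ : ℍ, c ((1 : ℝ) +ᵥ τ) = c τ) {f : ℤ⟦X⟧} (hf : ∀ n, f.coeff n ∈ I)
    (hs' : ∀ τ : ℍ, HasEval f (qParam s τ) (qParam s τ ^ N * c τ)) :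
    ∃ g : ℤ⟦X⟧, (∀ n, g.coeff n ∈ I) ∧
      ∀ τ : ℍ, HasEval g (qParam 1 τ) (qParam 1 τ ^ N * c τ) := by
  set z := Complex.exp (2 * Real.pi * Complex.I / s) with hzdef
  have hz : IsPrimitiveRoot z s := Complex.isPrimitiveRoot_exp s hs.ne'
  let F : ℤ⟦X⟧ := PowerSeries.X ^ (N * (s - 1)) * f
  have hF (τ : ℍ) :
      HasSum (fun n => (F.coeff n : ℂ) * qParam s τ ^ n) (qParam 1 τ ^ N * c τ) := by
    have h := ((hasEval_X (qParam s τ)).pow (N * (s - 1))).mul (hs' τ)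
    rw [hasEval_iff] at h
    convert h using 1
    rw [← mul_assoc, ← pow_add, ← qParam_pow_self hs, ← pow_mul]
    congr 2
    obtain ⟨t, rfl⟩ := Nat.exists_eq_add_of_le' hs
    simp only [Nat.add_sub_cancel]
    ring
  have hF' (τ : ℍ) :
      HasSum (fun n => (F.coeff n * z ^ n : ℂ) * qParam s τ ^ n) (qParam 1 τ ^ N * c τ) := by
    have h := hF ((1 : ℝ) +ᵥ τ)
    rw [hc, qParam_vadd_one, qParam_vadd] at h
    rw [← hzdef] at h
    simpa only [mul_pow, mul_assoc] using h
  have hco := coeff_eq_of_hasSum_qParam (by exact_mod_cast hs : (0 : ℝ) < s) hF hF'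
  have hzero (n : ℕ) (hn : ¬ s ∣ n) : F.coeff n = 0 := by
    by_contra hne
    have h := congrFun hco n
    have hne' : (F.coeff n : ℂ) ≠ 0 := by exact_mod_cast hne
    exact hn (hz.dvd_of_pow_eq_one n (mul_left_cancel₀ hne' (by rw [mul_one]; exact h.symm)))
  refine ⟨PowerSeries.mk fun n => F.coeff (s * n), fun n => ?_, fun τ => ?_⟩
  · rw [PowerSeries.coeff_mk, PowerSeries.coeff_X_pow_mul']
    split_ifs
    exacts [hf _, I.zero_mem]
  · rw [hasEval_iff]
    have h := (mul_right_injective₀ hs.ne' : Function.Injective fun n : ℕ => s * n).hasSum_iff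
      (f := fun n => (F.coeff n : ℂ) * qParam s τ ^ n) (a := qParam 1 τ ^ N * c τ) (fun n hn => by
        rw [hzero n fun ⟨k, hk⟩ => hn ⟨k, hk.symm⟩, Int.cast_zero, zero_mul])
    have h2 := h.mpr (hF τ)
    simpa only [Function.comp_def, pow_mul, qParam_pow_self hs, PowerSeries.coeff_mk] using h2

/-- An `SL(2, ℤ)`-invariant function with a finite-tailed expansion in `q ^ (1 / s)` whose
coefficients lie in an ideal `I` of `ℤ` is a polynomial in `j` with coefficients in `I`. -/
theorem exists_polynomial_j_of_hasEval_qParam {s : ℕ} (hs : 0 < s) (I : Ideal ℤ) {N : ℕ}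
    {c : ℍ → ℂ} (hc : ∀ (γ : SL(2, ℤ)) τ, c (γ • τ) = c τ) {f : ℤ⟦X⟧} (hf : ∀ n, f.coeff n ∈ I)
    (hs' : ∀ τ : ℍ, HasEval f (qParam s τ) (qParam s τ ^ N * c τ)) :
    ∃ g : ℤ[X], (∀ n, g.coeff n ∈ I) ∧ ∀ τ : ℍ, c τ = eval₂ (Int.castRingHom ℂ) (j τ) g := by
  obtain ⟨f', hf', hev⟩ := exists_hasEval_qParam_one hs I
    (fun τ => by rw [← modular_T_smul, hc]) hf hs'
  exact exists_polynomial_j_of_hasEval I N hc hf' hev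

lemma IsModularPolynomial.unique {s : ℕ} {F G : ℤ[X][X]} (hF : IsModularPolynomial s F)
    (hG : IsModularPolynomial s G) : F = G := by
  ext1 k
  refine eq_of_eval₂_j_eq fun τ => ?_
  have := congrArg (fun p => coeff p k) ((hF τ).trans (hG τ).symm)
  simpa only [coeff_map, coe_eval₂RingHom] using this

theorem exists_isModularPolynomial {s : ℕ} (hs : 0 < s) :
    ∃ F : ℤ[X][X], IsModularPolynomial s F := by
  have h (k : ℕ) : ∃ g : ℤ[X], ∀ τ : ℍ,
      (principalPoly s τ).coeff k = eval₂ (Int.castRingHom ℂ) (j τ) g := by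
    obtain ⟨f, hf⟩ := exists_cyclotomic_dvd_levelPoly hs k
    obtain ⟨g, -, hg⟩ := exists_polynomial_j_of_hasEval_qParam hs ⊤
      (c := fun τ : ℍ => (principalPoly s τ).coeff k)
      (fun γ τ => by rw [principalPoly_smul hs]) (fun _ => Submodule.mem_top)
      (hasEval_of_cyclotomic_dvd hs hf)
    exact ⟨g, hg⟩
  choose g hg using h
  refine ⟨∑ k ∈ Finset.range ((reps s).card + 1), monomial k (g k), fun τ => ?_⟩
  ext k
  rw [coeff_map, finsetSum_coeff]
  simp only [coeff_monomial, Finset.sum_ite_eq', Finset.mem_range]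
  split_ifs with hk
  · rw [hg k τ, coe_eval₂RingHom]
  · have hdeg : (principalPoly s τ).natDegree = (reps s).card := by
      rw [principalPoly, natDegree_prod_of_monic _ _ fun S _ => monic_X_sub_C _]
      simp
    rw [_root_.map_zero, coeff_eq_zero_of_natDegree_lt (by omega)]

lemma reps_prime {p : ℕ} (hp : p.Prime) : reps p = insert !![(p : ℤ), 0; 0, 1]
    ((Finset.range p).image fun b : ℕ => !![1, (b : ℤ); 0, (p : ℤ)]) := by
  ext S
  rw [Finset.mem_insert, Finset.mem_image]
  constructor
  · intro hS
    obtain ⟨a, b, d, had, hbd, hg, rfl⟩ := exists_nat_of_mem_reps hS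
    rcases (Nat.dvd_prime hp).mp ⟨d, had.symm⟩ with rfl | rfl
    · rw [one_mul] at had
      subst had
      exact .inr ⟨b, Finset.mem_range.mpr hbd, by simp⟩
    · have hd : d = 1 := Nat.eq_of_mul_eq_mul_left hp.pos (had.trans (mul_one _).symm)
      subst hd
      have hb : b = 0 := by omega
      subst hb
      exact .inl (by simp)
  · rintro (rfl | ⟨b, hb, rfl⟩)
    · exact_mod_cast nat_mem_reps hp.pos (a := p) (b := 0) (d := 1) (by simp) (by simp) (by simp)
    · exact_mod_cast nat_mem_reps hp.pos (a := 1) (b := b) (d := p) (by simp)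
        (Finset.mem_range.mp hb) (by simp)

@[to_additive]
lemma prod_reps_prime {M : Type*} [CommMonoid M] {p : ℕ} (hp : p.Prime)
    (φ : Matrix (Fin 2) (Fin 2) ℤ → M) : ∏ S ∈ reps p, φ S = φ !![(p : ℤ), 0; 0, 1] *
      ∏ b ∈ Finset.range p, φ !![1, (b : ℤ); 0, (p : ℤ)] := by
  rw [reps_prime hp, Finset.prod_insert, Finset.prod_image]
  · intro b _ b' _ h
    have : (b : ℤ) = b' := congrFun₂ h 0 1
    exact_mod_cast this
  · rw [Finset.mem_image]
    rintro ⟨b, -, h⟩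
    have : (1 : ℤ) = p := congrFun₂ h 0 0
    exact hp.one_lt.ne (by exact_mod_cast this)

lemma sum_reps_prime_sq {p : ℕ} (hp : p.Prime) :
    ∑ S ∈ reps p, (S 0 0).toNat ^ 2 = p ^ 2 + p := by
  rw [sum_reps_prime hp]
  simp

lemma substMonomial_one_left {R : Type*} [CommRing R] (f : R⟦X⟧) : substMonomial 1 1 f = f := by
  ext n
  simp [substMonomial]

lemma substMonomial_eq_expand {R : Type*} [CommRing R] {m : ℕ} (hm : m ≠ 0) (f : R⟦X⟧) :
    substMonomial m 1 f = PowerSeries.expand m hm f := by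
  ext n
  rw [PowerSeries.coeff_expand]
  simp [substMonomial]

lemma substMonomial_eq_pow {p : ℕ} [Fact p.Prime] (f : (ZMod p)⟦X⟧) :
    substMonomial p 1 f = f ^ p := by
  have hp : p ≠ 0 := (Fact.out : p.Prime).ne_zero
  rw [substMonomial_eq_expand hp]
  have := MvPowerSeries.map_frobenius_expand p hp (f := f)
  rw [ZMod.frobenius_zmod] at this
  rw [← this]
  exact (congrFun PowerSeries.map_id _).symm

/-- The power series version of `(X ^ p - Y) (X - Y ^ p)` at `Y = j`, with denominators in
`Q = q ^ (1 / p)` cleared. -/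
def kroneckerSeries (R : Type*) [CommRing R] (p : ℕ) : R⟦X⟧[X] :=
  (C (PowerSeries.X ^ p) * X ^ p - C (substMonomial p 1 (jSeries.map (Int.castRingHom R)))) *
    (C (PowerSeries.X ^ p ^ 2) * X -
      C (substMonomial p 1 (jSeries.map (Int.castRingHom R)) ^ p))

lemma map_kroneckerSeries {R S : Type*} [CommRing R] [CommRing S] (φ : R →+* S) (p : ℕ) :
    (kroneckerSeries R p).map (PowerSeries.map φ) = kroneckerSeries S p := by
  have h : (jSeries.map (Int.castRingHom R)).map φ = jSeries.map (Int.castRingHom S) := by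
    ext n
    simp
  simp [kroneckerSeries, map_substMonomial, h]

lemma kroneckerSeries_mem_polySeriesGraph {p : ℕ} (hp : p.Prime) (τ : ℍ) :
    (kroneckerSeries ℂ p, C (qParam p τ ^ (p ^ 2 + p)) *
      ((X ^ p - C (j τ)) * (X - C (j τ) ^ p))) ∈ polySeriesGraph (qParam p τ) := by
  set Q := qParam p τ
  have hX (m : ℕ) : (PowerSeries.X ^ m, Q ^ m) ∈ seriesGraph Q := pow_mem (X_mem_seriesGraph Q) m
  have hsub : (substMonomial p 1 (jSeries.map (Int.castRingHom ℂ)), Q ^ p * j τ) ∈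
      seriesGraph Q := by
    refine substMonomial_mem_seriesGraph hp.pos ?_
    have := hasSum_jSeries τ
    rw [← qParam_pow_self hp.pos] at this
    simpa using this
  have hpow : (substMonomial p 1 (jSeries.map (Int.castRingHom ℂ)) ^ p, (Q ^ p * j τ) ^ p) ∈
      seriesGraph Q := pow_mem hsub p
  have hXp : (X ^ p, X ^ p) ∈ polySeriesGraph Q := pow_mem (X_mem_polySeriesGraph Q) p
  have h := mul_mem
    (sub_mem (mul_mem (C_mem_polySeriesGraph (hX p)) hXp)
      (C_mem_polySeriesGraph hsub))
    (sub_mem (mul_mem (C_mem_polySeriesGraph (hX (p ^ 2))) (X_mem_polySeriesGraph Q))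
      (C_mem_polySeriesGraph hpow))
  simp only [Prod.mk_mul_mk, Prod.mk_sub_mk] at h
  have e : C (Q ^ (p ^ 2 + p)) * ((X ^ p - C (j τ)) * (X - C (j τ) ^ p)) =
      (C (Q ^ p) * X ^ p - C (Q ^ p * j τ)) * (C (Q ^ p ^ 2) * X - C ((Q ^ p * j τ) ^ p)) := by
    simp only [map_mul, map_pow]
    ring
  rw [e]
  exact h

lemma levelPoly_zmod {p : ℕ} (hp : p.Prime) :
    levelPoly p (1 : ZMod p) = kroneckerSeries (ZMod p) p := by
  have : Fact p.Prime := ⟨hp⟩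
  have hchar : CharP (ZMod p)⟦X⟧[X] p := by
    refine charP_of_injective_ringHom (f := (C : (ZMod p)⟦X⟧ →+* _).comp PowerSeries.C) ?_ p
    exact C_injective.comp PowerSeries.C_injective
  set f := jSeries.map (Int.castRingHom (ZMod p)) with hf
  have h1 : substMonomial (p ^ 2) 1 f = (f ^ p) ^ p := by
    rw [← substMonomial_eq_pow, ← substMonomial_eq_pow, substMonomial_eq_expand hp.ne_zero,
      substMonomial_eq_expand hp.ne_zero, substMonomial_eq_expand (pow_ne_zero 2 hp.ne_zero),
      ← PowerSeries.expand_mul]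
    simp only [pow_two]
  have h2 : levelFactor p 1 (1 : ZMod p) = C PowerSeries.X * X - C f := by
    simp [levelFactor, substMonomial_one_left, hf]
  have h3 : levelFactor p (p ^ 2) (1 : ZMod p) =
      C (PowerSeries.X ^ p ^ 2) * X - C ((f ^ p) ^ p) := by
    rw [← h1, levelFactor, one_pow, _root_.map_one, one_mul]
  have h4 : levelPoly p (1 : ZMod p) =
      levelFactor p (p ^ 2) (1 : ZMod p) * levelFactor p 1 (1 : ZMod p) ^ p := by
    rw [levelPoly, prod_reps_prime hp]
    simp
  rw [h4, h3, h2, sub_pow_char, kroneckerSeries, ← hf, substMonomial_eq_pow, mul_comm]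
  simp only [mul_pow, map_pow]

theorem natCast_dvd_sub_of_isModularPolynomial {p : ℕ} (hp : p.Prime) {F : ℤ[X][X]}
    (hF : IsModularPolynomial p F) :
    (p : ℤ[X][X]) ∣ F - (X ^ p - C X) * (X - C X ^ p) := by
  have : Fact p.Prime := ⟨hp⟩
  set H : ℤ[X][X] := (X ^ p - C X) * (X - C X ^ p) with hH
  have hHmap (τ : ℍ) : H.map (eval₂RingHom (Int.castRingHom ℂ) (j τ)) =
      (X ^ p - C (j τ)) * (X - C (j τ) ^ p) := by
    simp [hH]
  suffices h : ∀ k, (C (p : ℤ) : ℤ[X]) ∣ (F - H).coeff k by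
    have := (C_dvd_iff_dvd_coeff _ _).mpr h
    simpa using this
  intro k
  obtain ⟨f, hf⟩ := exists_cyclotomic_dvd_levelPoly hp.pos k
  let r := (kroneckerSeries ℤ p).coeff k
  have hcoeff (n : ℕ) : (f - r).coeff n ∈ Ideal.span {(p : ℤ)} := by
    let φ : ℤ[X] →+* ZMod p := eval₂RingHom (Int.castRingHom _) 1
    have hcyc : φ (cyclotomic p ℤ) = 0 := by
      rw [coe_eval₂RingHom, ← eval_map, map_cyclotomic, eval_one_cyclotomic_prime]
      simp
    have h1 : φ (((levelPoly p (X : ℤ[X])).coeff k).coeff n) = (f.coeff n : ZMod p) := by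
      obtain ⟨g, hg⟩ := hf n
      have := congrArg φ hg
      rw [map_mul, hcyc, zero_mul, map_sub, sub_eq_zero] at this
      simpa [φ] using this
    have h2 : φ (((levelPoly p (X : ℤ[X])).coeff k).coeff n) = (r.coeff n : ZMod p) := by
      rw [← PowerSeries.coeff_map, ← coeff_map, map_levelPoly]
      have hφ : φ X = 1 := by simp [φ]
      rw [hφ, levelPoly_zmod hp, ← map_kroneckerSeries (Int.castRingHom (ZMod p)), coeff_map,
        PowerSeries.coeff_map, eq_intCast]
    rw [Ideal.mem_span_singleton, ← ZMod.intCast_zmod_eq_zero_iff_dvd, map_sub, Int.cast_sub,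
      ← h1, ← h2, sub_self]
  have heval (τ : ℍ) : HasEval (f - r) (qParam p τ) (qParam p τ ^ (p ^ 2 + p) *
      eval₂ (Int.castRingHom ℂ) (j τ) ((F - H).coeff k)) := by
    have h1 := hasEval_of_cyclotomic_dvd hp.pos hf τ
    rw [sum_reps_prime_sq hp, ← hF τ, coeff_map, coe_eval₂RingHom] at h1
    have h2 : HasEval r (qParam p τ) (qParam p τ ^ (p ^ 2 + p) *
        eval₂ (Int.castRingHom ℂ) (j τ) (H.coeff k)) := by
      have h := kroneckerSeries_mem_polySeriesGraph hp τ k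
      rw [← hHmap τ, ← map_kroneckerSeries (Int.castRingHom ℂ)] at h
      simp only [coeff_C_mul, coeff_map, coe_eval₂RingHom] at h
      exact h
    rw [coeff_sub, eval₂_sub, mul_sub]
    exact h1.sub h2
  obtain ⟨g, hg, hgj⟩ := exists_polynomial_j_of_hasEval_qParam hp.pos _
    (fun γ τ => by simp only [j_smul]) hcoeff heval
  rw [eq_of_eval₂_j_eq hgj]
  exact (C_dvd_iff_dvd_coeff _ _).mpr fun n => Ideal.mem_span_singleton.mp (hg n)

end

end ModularTransformation

theorem mainTheorem3 :
    (∀ s : ℕ, 0 < s → ∃! F : ℤ[X][X], ModularTransformation.IsModularPolynomial s F) ∧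
    (∀ p : ℕ, p.Prime → ∀ F : ℤ[X][X], ModularTransformation.IsModularPolynomial p F →
      (p : ℤ[X][X]) ∣ F - (X ^ p - C X) * (X - C X ^ p)) := by
  refine ⟨fun s hs => ?_, fun p hp F hF =>
    ModularTransformation.natCast_dvd_sub_of_isModularPolynomial hp hF⟩
  obtain ⟨F, hF⟩ := ModularTransformation.exists_isModularPolynomial hs
  exact ⟨F, hF, fun G hG => hG.unique hF⟩
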